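/- Let $p$ be an odd prime, let $n_1$ be a positive integer coprime to $p$, let $m$ be the least positive integer with $p^m\equiv 1 \pmod{n_1}$, and put $q=p^m$, $N=\frac{q-1}{n_1}$ and $N_1=\gcd\left(N,\frac{q-1}{p-1}\right)$. Let $\alpha$ be a primitive element of $\mathbb{F}_q$, let $\theta=\alpha^N$, let $\mathrm{Tr}$ be the trace from $\mathbb{F}_q$ to $\mathbb{F}_p$, and let $D=\{\theta^i : 0\le i<n_1\}$. Consider the linear code $$C_D=\{(\mathrm{Tr}(a\theta^0),\mathrm{Tr}(a\theta^1),\ldots,\mathrm{Tr}(a\theta^{n_1-1})) : a\in\mathbb{F}_q\}\subseteq\mathbb{F}_p^{n_1}.$$ For a linear code $C$ over $\mathbb{F}_p$ and $1\le r\le\dim C$, let $d_r(C)$ be the $r$-th generalized Hamming weight of $C$, i.e. the minimum of $|\mathrm{Supp}(U)|$ over all $r$-dimensional subspaces $U\subseteq C$, where $\mathrm{Supp}(U)$ is the set of coordinates $i$ such that $x_i\ne 0$ for some $x\in U$. If $N_1=3$, $p\equiv 2\pmod 3$ and $m\equiv 2\pmod 4$, then for $1\le r\le \frac m2$, $$d_r(C_D)=\left(1-\frac1{p^r}\right)\frac{q-2\sqrt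 q}{N}.$$ -/

import Mathlib

/-- The code `{(Tr (a * d i))_i : a ∈ F}` over `K` attached to a list `d` of elements of `F`. -/
noncomputable def traceCode (K : Type*) {F : Type*} [Field K] [Field F] [Algebra K F]
    {n : ℕ} (d : Fin n → F) : Submodule K (Fin n → K) :=
  LinearMap.range (LinearMap.pi fun i => Algebra.trace K F ∘ₗ LinearMap.mulRight K (d i))

theorem mem_traceCode {K F : Type*} [Field K] [Field F] [Algebra K F]
    {n : ℕ} (d : Fin n → F) (x : Fin n → K) :
    x ∈ traceCode K d ↔ ∃ a : F, (fun i => Algebra.trace K F (a * d i)) = x :=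
  Iff.rfl

/-- The support of a subspace of `K ^ n`: the coordinates at which some vector in it is nonzero. -/
def codeSupport {K : Type*} [Field K] {n : ℕ} (U : Submodule K (Fin n → K)) : Set (Fin n) :=
  {i | ∃ x ∈ U, x i ≠ 0}

/-- The `r`-th generalized Hamming weight: the least support size of an `r`-dimensional
subspace of `C`. (It takes the value `0` when `r > dim C`, where the weight is not defined.) -/
noncomputable def genHammingWeight {K : Type*} [Field K] {n : ℕ}
    (C : Submodule K (Fin n → K)) (r : ℕ) : ℕ :=
  sInf {w | ∃ U : Submodule K (Fin n → K),
    U ≤ C ∧ Module.finrank K U = r ∧ (codeSupport U).ncard = w}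

section

open Finset

/-! Put `s = p ^ k` with `m = 2k`, `k` odd, so `q = s²`, `3 ∣ s + 1` and `e = (s + 1) / 3` is even.
The nonzero cubes split into `e` cosets of `𝔽_s^*`. On each coset `x ↦ Tr (a * x)` is the
restriction of an `𝔽_p`-linear functional on `𝔽_s`, which vanishes exactly on the coset with `(a *
y) ^ (s - 1) = -1`; this occurs once if `a` is a cube, otherwise never
(`card_cubes_trace_ne_zero_mul`). Since `N₁ = 3`, the set `D` and `𝔽_p^*` generate the cubes, so
`card_filter_mul_card_eq` carries the count over to `D`: there are two weights, the smaller one for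
cubes `a`. Double counting turns the weights in a subspace into its support size, so the minimum
weight bounds `d_r` from below. Equality holds on the image of an `r`-dimensional subspace of `𝔽_s`,
whose nonzero elements are all cubes; this is where `r ≤ m / 2` enters. -/

theorem card_filter_linearMap_ne_zero {K V : Type*} [Field K] [Fintype K] [DecidableEq K]
    [AddCommGroup V] [Module K V] [Fintype V] (f : V →ₗ[K] K) (hf : f ≠ 0) :
    #{v | f v ≠ 0} * Fintype.card K = (Fintype.card K - 1) * Fintype.card V := by
  have h1 : #{v | f v = 0} = Nat.card (LinearMap.ker f) := by
    rw [← Fintype.card_subtype, ← Nat.card_eq_fintype_card]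
    exact Nat.card_congr (Equiv.refl _)
  have h2 : Fintype.card V = Fintype.card K * #{v | f v = 0} := by
    rw [h1, ← Nat.card_eq_fintype_card, ← Nat.card_eq_fintype_card (α := K),
      Submodule.card_eq_card_quotient_mul_card (LinearMap.ker f),
      Nat.card_congr (f.quotKerEquivOfSurjective (LinearMap.surjective hf)).toEquiv]
    ring
  have h3 : #{v | f v = 0} + #{v | f v ≠ 0} = Fintype.card V :=
    card_filter_add_card_filter_not (s := univ) (fun v => f v = 0)
  obtain ⟨c, hc⟩ : ∃ c, Fintype.card K = c + 1 :=
    Nat.exists_eq_succ_of_ne_zero Fintype.card_ne_zero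
  rw [← h3, hc] at h2
  rw [← h3, hc]
  have : #{v | f v ≠ 0} = c * #{v | f v = 0} := by linarith
  rw [this, Nat.add_sub_cancel]
  ring

/-! ### Counting roots of unity -/

section FiniteField

variable {F : Type*} [Field F] [Fintype F] [DecidableEq F]

theorem card_filter_pow_eq_one {d : ℕ} {ζ : F} (hζ : IsPrimitiveRoot ζ d) (hd : 0 < d) :
    #{x : F | x ^ d = 1} = d := by
  conv_rhs => rw [← hζ.card_nthRootsFinset]
  congr 1
  ext x
  simp [Polynomial.mem_nthRootsFinset hd]

/-- If the `a`-th and the `b`-th roots of unity together generate the `c`-th ones, then a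
predicate invariant under the `a`-th roots of unity has the same density among the `b`-th roots
of unity as among the `c`-th ones. -/
theorem card_filter_mul_card_eq {a b c : ℕ} (hb : b ≠ 0) (ha : a ≠ 0)
    (hac : a ∣ c) (hbc : b ∣ c)
    (hgen : ∀ y : F, y ^ c = 1 → ∃ u v : F, u ^ a = 1 ∧ v ^ b = 1 ∧ u * v = y)
    (S : F → Prop) [DecidablePred S] (hS : ∀ u y, u ^ a = 1 → (S (u * y) ↔ S y)) :
    #{x : F | x ^ b = 1 ∧ S x} * #{x : F | x ^ c = 1} =
      #{x : F | x ^ b = 1} * #{x : F | x ^ c = 1 ∧ S x} := by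
  set A : Finset F := {x | x ^ a = 1} with hA
  set B : Finset F := {x | x ^ b = 1} with hB
  have ne0 : ∀ {n : ℕ} {x : F}, n ≠ 0 → x ^ n = 1 → x ≠ 0 := by
    rintro n x hn h rfl
    simp [hn] at h
  -- Fibres of multiplication are translates of its kernel, hence equal in size.
  have hfib : ∀ y : F, y ^ c = 1 →
      #{w ∈ A ×ˢ B | w.1 * w.2 = y} = #{w ∈ A ×ˢ B | w.1 * w.2 = 1} := by
    intro y hy
    obtain ⟨u, v, hu, hv, rfl⟩ := hgen y hy
    have hu0 := ne0 ha hu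
    have hv0 := ne0 hb hv
    refine card_bij' (fun w _ => (w.1 * u⁻¹, w.2 * v⁻¹)) (fun w _ => (w.1 * u, w.2 * v))
      ?_ ?_ ?_ ?_
    · rintro ⟨x, z⟩ h
      simp only [hA, hB, mem_filter, mem_product, mem_univ, true_and] at h ⊢
      refine ⟨⟨by simp [mul_pow, h.1.1, hu], by simp [mul_pow, h.1.2, hv]⟩, ?_⟩
      calc x * u⁻¹ * (z * v⁻¹) = (x * z) * (u * v)⁻¹ := by rw [mul_inv]; ring
        _ = 1 := by rw [h.2]; exact mul_inv_cancel₀ (mul_ne_zero hu0 hv0)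
    · rintro ⟨x, z⟩ h
      simp only [hA, hB, mem_filter, mem_product, mem_univ, true_and] at h ⊢
      refine ⟨⟨by simp [mul_pow, h.1.1, hu], by simp [mul_pow, h.1.2, hv]⟩, ?_⟩
      calc x * u * (z * v) = (x * z) * (u * v) := by ring
        _ = u * v := by rw [h.2, one_mul]
    · rintro ⟨x, z⟩ h
      simp [hu0, hv0]
    · rintro ⟨x, z⟩ h
      simp [hu0, hv0]
  have key : ∀ (T : F → Prop) [DecidablePred T], (∀ u y, u ^ a = 1 → (T (u * y) ↔ T y)) →
      #A * #{x : F | x ^ b = 1 ∧ T x} =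
        #{x : F | x ^ c = 1 ∧ T x} * #{w ∈ A ×ˢ B | w.1 * w.2 = 1} := by
    intro T _ hT
    have h1 : #{w ∈ A ×ˢ B | T (w.1 * w.2)} = #A * #{x : F | x ^ b = 1 ∧ T x} := by
      rw [← card_product]
      congr 1
      ext ⟨x, z⟩
      simp only [hA, hB, mem_filter, mem_product, mem_univ, true_and, and_assoc]
      exact and_congr_right fun hx => and_congr_right fun _ => hT x z hx
    rw [← h1, card_eq_sum_card_fiberwise (f := fun w => w.1 * w.2)
      (t := ({x : F | x ^ c = 1 ∧ T x} : Finset F)), sum_const_nat]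
    · intro y hy
      simp only [mem_filter, mem_univ, true_and] at hy
      rw [← hfib y hy.1, filter_filter]
      congr 1
      ext w
      simp only [mem_filter]
      refine and_congr_right fun _ => ⟨fun h => h.2, fun h => ⟨h ▸ hy.2, h⟩⟩
    · rintro ⟨x, z⟩ h
      simp only [hA, hB, mem_filter, mem_product, mem_univ, true_and, coe_filter,
        Set.mem_ofPred_eq] at h ⊢
      refine ⟨?_, h.2⟩
      obtain ⟨i, rfl⟩ := hac
      rw [mul_pow, pow_mul, h.1.1, one_pow, one_mul]
      obtain ⟨j, hj⟩ := hbc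
      rw [hj, pow_mul, h.1.2, one_pow]
  have k1 := key S hS
  have k2 := key (fun _ => True) (by simp)
  simp only [and_true] at k2
  have hA0 : 0 < #A := card_pos.2 ⟨1, by simp [hA]⟩
  refine Nat.eq_of_mul_eq_mul_left hA0 ?_
  rw [← mul_assoc, k1, ← mul_assoc, k2]
  ring

end FiniteField

/-! ### The subfield of order `p ^ k` -/

/-- The subfield of order `p ^ k`, as a subspace. -/
def fixedSubmodule (p k : ℕ) [Fact p.Prime] (F : Type*) [Field F] [Algebra (ZMod p) F] :
    Submodule (ZMod p) F where
  carrier := {x | x ^ p ^ k = x}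
  add_mem' {x y} hx hy := by
    have : CharP F p := charP_of_injective_algebraMap (algebraMap (ZMod p) F).injective p
    simp only [Set.mem_ofPred_eq] at hx hy ⊢
    rw [add_pow_char_pow, hx, hy]
  zero_mem' := zero_pow (pow_ne_zero _ (Fact.out : p.Prime).ne_zero)
  smul_mem' c x hx := by
    simp only [Set.mem_ofPred_eq] at hx ⊢
    rw [Algebra.smul_def, mul_pow, hx, ← map_pow, ZMod.pow_card_pow]

theorem mem_fixedSubmodule {p : ℕ} [Fact p.Prime] {F : Type*} [Field F] [Algebra (ZMod p) F]
    {k : ℕ} {x : F} : x ∈ fixedSubmodule p k F ↔ x ^ p ^ k = x := Iff.rfl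

theorem pow_eq_self_iff_of_ne_zero {p : ℕ} [Fact p.Prime] {F : Type*} [Field F] {k : ℕ} {x : F}
    (hx : x ≠ 0) :
    x ^ p ^ k = x ↔ x ^ (p ^ k - 1) = 1 := by
  have h : p ^ k = p ^ k - 1 + 1 := (Nat.sub_add_cancel
    (Nat.one_le_pow _ _ (Fact.out : p.Prime).pos)).symm
  conv_lhs => rw [h, pow_succ]
  exact mul_eq_right₀ hx

theorem pow_eq_neg_self_iff_of_ne_zero {p : ℕ} [Fact p.Prime] {F : Type*} [Field F] {k : ℕ} {x : F}
    (hx : x ≠ 0) :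
    x ^ p ^ k = -x ↔ x ^ (p ^ k - 1) = -1 := by
  have h : p ^ k = p ^ k - 1 + 1 := (Nat.sub_add_cancel
    (Nat.one_le_pow _ _ (Fact.out : p.Prime).pos)).symm
  conv_lhs => rw [h, pow_succ, ← neg_one_mul x]
  exact mul_left_inj' hx

/-! ### Trace duality with the subfield -/

section Trace

variable {p : ℕ} [Fact p.Prime] {F : Type*} [Field F] [Finite F] [Algebra (ZMod p) F]

theorem trace_pow_char_pow (k : ℕ) (x : F) :
    Algebra.trace (ZMod p) F (x ^ p ^ k) = Algebra.trace (ZMod p) F x := by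
  induction k with
  | zero => simp
  | succ k ih =>
    rw [pow_succ, pow_mul, ← ih]
    have := Algebra.trace_eq_of_algEquiv
      (FiniteField.frobeniusAlgEquivOfAlgebraic (ZMod p) F) (x ^ p ^ k)
    simpa [FiniteField.coe_frobeniusAlgEquivOfAlgebraic, ZMod.card] using this

theorem eq_zero_of_forall_trace_mul_eq_zero {y : F}
    (h : ∀ z, Algebra.trace (ZMod p) F (y * z) = 0) : y = 0 :=
  (traceForm_nondegenerate (ZMod p) F).1 y fun z => by simpa [Algebra.traceForm_apply] using h z

/-- The map `x ↦ x ^ p ^ k` is a trace-preserving involution, and the trace form is nondegenerate: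
the orthogonal complement of its fixed space is its `-1` eigenspace. -/
theorem forall_trace_mul_eq_zero_iff (hp : p ≠ 2) {k : ℕ} (hF : Nat.card F = (p ^ k) ^ 2) (y : F) :
    (∀ t : F, t ^ p ^ k = t → Algebra.trace (ZMod p) F (y * t) = 0) ↔ y ^ p ^ k = -y := by
  have : Fintype F := Fintype.ofFinite F
  have : CharP F p := charP_of_injective_algebraMap (algebraMap (ZMod p) F).injective p
  have hsq : ∀ x : F, (x ^ p ^ k) ^ p ^ k = x := fun x => by
    rw [← pow_mul, ← sq, ← hF, Nat.card_eq_fintype_card, FiniteField.pow_card]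
  constructor
  · intro h
    rw [← add_eq_zero_iff_eq_neg]
    refine eq_zero_of_forall_trace_mul_eq_zero (p := p) fun z => ?_
    -- The relative trace of an arbitrary `z` lies in the subfield.
    have h1 := h (z + z ^ p ^ k) (by rw [add_pow_char_pow, hsq, add_comm])
    rw [mul_add, map_add, ← trace_pow_char_pow k (y * z ^ p ^ k), mul_pow, hsq, ← map_add] at h1
    rw [add_mul, add_comm, h1]
  · intro h t ht
    have h1 := trace_pow_char_pow (p := p) k (y * t)
    rw [mul_pow, h, ht, neg_mul, map_neg] at h1
    have h2 : (2 : ZMod p) ≠ 0 := Ring.two_ne_zero (by rwa [ZMod.ringChar_zmod_n])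
    exact (mul_eq_zero.1 (show (2 : ZMod p) * Algebra.trace (ZMod p) F (y * t) = 0 by
      rw [two_mul]; nth_rewrite 1 [← h1]; exact neg_add_cancel _)).resolve_left h2

theorem card_fixedSubmodule {k : ℕ} {ζ : F} (hk : k ≠ 0) (hζ : IsPrimitiveRoot ζ (p ^ k - 1)) :
    Nat.card (fixedSubmodule p k F) = p ^ k := by
  classical
  have : Fintype F := Fintype.ofFinite F
  have h1 : 1 < p ^ k := Nat.one_lt_pow hk (Fact.out : p.Prime).one_lt
  have h2 : Nat.card (fixedSubmodule p k F) =
      #(insert 0 ({x | x ^ (p ^ k - 1) = 1} : Finset F)) := by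
    refine Nat.subtype_card _ fun x => ?_
    rcases eq_or_ne x 0 with rfl | hx
    · simp
    · simp [hx, mem_fixedSubmodule, pow_eq_self_iff_of_ne_zero hx]
  rw [h2, card_insert_of_notMem, card_filter_pow_eq_one hζ (by omega)]
  · omega
  · have : p ^ k - 1 ≠ 0 := by omega
    simp [this]

end Trace

/-! ### Traces on cosets of the subfield and on the cubes -/

section Cubes

variable {p : ℕ} [Fact p.Prime] {F : Type*} [Field F] [Fintype F] [DecidableEq F]
  [Algebra (ZMod p) F]

theorem card_filter_pow_eq_neg_one {n : ℕ} {β : F} (hn : n ≠ 0) (hβ : β ^ n = -1) :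
    #{x : F | x ^ n = -1} = #{x : F | x ^ n = 1} := by
  have hβ0 : β ≠ 0 := by
    rintro rfl
    simp [hn] at hβ
  refine card_bij' (fun x _ => x * β) (fun x _ => x * β⁻¹) ?_ ?_ ?_ ?_
  · intro x hx
    simp only [mem_filter, mem_univ, true_and] at hx ⊢
    rw [mul_pow, hx, hβ, neg_one_mul, neg_neg]
  · intro x hx
    simp only [mem_filter, mem_univ, true_and] at hx ⊢
    rw [mul_pow, hx, inv_pow, hβ, inv_neg, inv_one, one_mul]
  · intro x _
    simp [hβ0]
  · intro x _
    simp [hβ0]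

theorem card_filter_trace_mul_ne_zero_mul (hp : p ≠ 2) {k : ℕ} (hk : k ≠ 0)
    (hF : Nat.card F = (p ^ k) ^ 2) {ζ : F} (hζ : IsPrimitiveRoot ζ (p ^ k - 1)) {z : F}
    (hz : z ≠ 0) :
    #{t : F | t ^ (p ^ k - 1) = 1 ∧ Algebra.trace (ZMod p) F (z * t) ≠ 0} * p =
      if z ^ (p ^ k - 1) = -1 then 0 else (p - 1) * p ^ k := by
  have h1 : 1 < p ^ k := Nat.one_lt_pow hk (Fact.out : p.Prime).one_lt
  split_ifs with h
  · rw [← pow_eq_neg_self_iff_of_ne_zero hz, ← forall_trace_mul_eq_zero_iff hp hF] at h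
    rw [card_eq_zero.2, zero_mul]
    refine filter_eq_empty_iff.2 fun t _ ht => ht.2 (h t ?_)
    refine (pow_eq_self_iff_of_ne_zero ?_).2 ht.1
    rintro rfl
    simp at ht
  · rw [← pow_eq_neg_self_iff_of_ne_zero hz, ← forall_trace_mul_eq_zero_iff hp hF] at h
    push Not at h
    obtain ⟨t₀, ht₀, h0⟩ := h
    let f : fixedSubmodule p k F →ₗ[ZMod p] ZMod p :=
      (Algebra.trace (ZMod p) F ∘ₗ LinearMap.mulLeft (ZMod p) z) ∘ₗ (fixedSubmodule p k F).subtype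
    have hf : f ≠ 0 := fun hf => h0 (LinearMap.congr_fun hf ⟨t₀, ht₀⟩)
    have : Fintype (fixedSubmodule p k F) := Fintype.ofFinite _
    have key := card_filter_linearMap_ne_zero f hf
    rw [ZMod.card, ← Nat.card_eq_fintype_card, card_fixedSubmodule hk hζ] at key
    rw [← key, ← card_map (Function.Embedding.subtype _)]
    congr 2
    ext t
    simp only [mem_filter, mem_univ, true_and, mem_map, Function.Embedding.subtype_apply]
    constructor
    · rintro ⟨ht, h2⟩
      have ht0 : t ≠ 0 := by
        rintro rfl
        simp at h2
      exact ⟨⟨t, (pow_eq_self_iff_of_ne_zero ht0).2 ht⟩, h2, rfl⟩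
    · rintro ⟨⟨t, ht⟩, h2, rfl⟩
      have ht0 : t ≠ 0 := by
        rintro rfl
        exact h2 (map_zero f)
      exact ⟨(pow_eq_self_iff_of_ne_zero ht0).1 ht, h2⟩

/-- The number of nonzero cubes `y` in a field of order `p ^ (2 * k)` with `Tr (a * y) ≠ 0`. -/
theorem card_cubes_trace_ne_zero_mul (hp : p ≠ 2) {k : ℕ} (hk : k ≠ 0)
    (hF : Nat.card F = (p ^ k) ^ 2) {α : F} (hα : IsPrimitiveRoot α ((p ^ k) ^ 2 - 1))
    {e : ℕ} (he : 3 * e = p ^ k + 1) (he2 : Even e) {a : F} (ha : a ≠ 0) :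
    #{y : F | y ^ ((p ^ k - 1) * e) = 1 ∧ Algebra.trace (ZMod p) F (a * y) ≠ 0} * p =
      (p - 1) * p ^ k * (e - if a ^ ((p ^ k - 1) * e) = 1 then 1 else 0) := by
  have h1 : 1 < p ^ k := Nat.one_lt_pow hk (Fact.out : p.Prime).one_lt
  set s := p ^ k with hs
  have hsq : s ^ 2 - 1 = (s - 1) * e * 3 := by
    rw [mul_assoc, mul_comm e, he, mul_comm, ← Nat.sq_sub_sq, one_pow]
  obtain ⟨j, hj⟩ := he2
  have he0 : 0 < e := by omega
  have hpos : 0 < s ^ 2 - 1 := by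
    rw [hsq]
    have : 0 < s - 1 := by omega
    positivity
  have hζ : IsPrimitiveRoot (α ^ (e * 3)) (s - 1) :=
    hα.pow hpos (by rw [hsq]; ring)
  have hc : IsPrimitiveRoot (α ^ 3) ((s - 1) * e) := hα.pow hpos (by rw [hsq]; ring)
  have hcpos : 0 < (s - 1) * e := Nat.mul_pos (by omega) he0
  -- With `e = 2j`, the exponent `3j(s - 1)` is half the order of `α`.
  have hβ : (α ^ (3 * j)) ^ (s - 1) = -1 := by
    have h2 : IsPrimitiveRoot ((α ^ (3 * j)) ^ (s - 1)) 2 := by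
      rw [← pow_mul]
      exact hα.pow hpos (by rw [hsq, hj]; ring)
    exact h2.eq_neg_one_of_two_right
  have hT : #{t : F | t ^ (s - 1) = 1} = s - 1 := card_filter_pow_eq_one hζ (by omega)
  have hP : #{y : F | y ^ ((s - 1) * e) = 1} = (s - 1) * e := card_filter_pow_eq_one hc hcpos
  have hE : #{x : F | x ^ (s - 1) = -1} = s - 1 := by
    rw [card_filter_pow_eq_neg_one (by omega) hβ, hT]
  have hEP : ∀ x : F, x ^ (s - 1) = -1 → x ^ ((s - 1) * e) = 1 := fun x hx => by
    rw [pow_mul, hx, Even.neg_one_pow ⟨j, hj⟩]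
  have hN : #{y : F | y ^ ((s - 1) * e) = 1 ∧ (a * y) ^ (s - 1) = -1} =
      (s - 1) * if a ^ ((s - 1) * e) = 1 then 1 else 0 := by
    split_ifs with h
    · rw [mul_one]
      refine Eq.trans (card_bij' (fun y _ => a * y) (fun x _ => a⁻¹ * x) ?_ ?_ ?_ ?_) hE
      · intro y hy
        simp only [mem_filter, mem_univ, true_and] at hy ⊢
        exact hy.2
      · intro x hx
        simp only [mem_filter, mem_univ, true_and] at hx ⊢
        rw [mul_inv_cancel_left₀ ha]
        exact ⟨by rw [mul_pow, inv_pow, h, hEP x hx, inv_one, one_mul], hx⟩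
      · intro y _
        exact inv_mul_cancel_left₀ ha y
      · intro y _
        exact mul_inv_cancel_left₀ ha y
    · rw [mul_zero, card_eq_zero]
      refine filter_eq_empty_iff.2 fun y _ hy => h ?_
      have := hEP _ hy.2
      rwa [mul_pow, hy.1, mul_one] at this
  have hN' : #{y : F | y ^ ((s - 1) * e) = 1 ∧ ¬ (a * y) ^ (s - 1) = -1} =
      (s - 1) * (e - if a ^ ((s - 1) * e) = 1 then 1 else 0) := by
    have := card_filter_add_card_filter_not (s := ({y : F | y ^ ((s - 1) * e) = 1} : Finset F))
      (fun y => (a * y) ^ (s - 1) = -1)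
    rw [filter_filter, filter_filter, hP, hN] at this
    rw [Nat.mul_sub]
    omega
  -- Count pairs `(y, t)`: for fixed `t`, `y ↦ y * t` permutes the cubes; for fixed `y`, one coset
  -- of `𝔽_s^*` is seen.
  have hswap := sum_card_bipartiteAbove_eq_sum_card_bipartiteBelow
    (s := ({y : F | y ^ ((s - 1) * e) = 1} : Finset F))
    (t := ({t : F | t ^ (s - 1) = 1} : Finset F))
    (fun y t => Algebra.trace (ZMod p) F (a * y * t) ≠ 0)
  have hleft : ∀ t ∈ ({t : F | t ^ (s - 1) = 1} : Finset F),
      #(bipartiteBelow (fun y t => Algebra.trace (ZMod p) F (a * y * t) ≠ 0)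
        ({y : F | y ^ ((s - 1) * e) = 1} : Finset F) t) =
      #{y : F | y ^ ((s - 1) * e) = 1 ∧ Algebra.trace (ZMod p) F (a * y) ≠ 0} := by
    intro t ht
    simp only [mem_filter, mem_univ, true_and] at ht
    have ht0 : t ≠ 0 := by
      rintro rfl
      simp [show s - 1 ≠ 0 by omega] at ht
    have htc : t ^ ((s - 1) * e) = 1 := by rw [pow_mul, ht, one_pow]
    rw [bipartiteBelow, filter_filter]
    refine card_bij' (fun y _ => y * t) (fun y _ => y * t⁻¹) ?_ ?_ ?_ ?_
    · intro y hy
      simp only [mem_filter, mem_univ, true_and] at hy ⊢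
      rw [mul_pow, hy.1, htc, mul_one, ← mul_assoc]
      exact ⟨rfl, hy.2⟩
    · intro y hy
      simp only [mem_filter, mem_univ, true_and] at hy ⊢
      rw [mul_pow, hy.1, inv_pow, htc, inv_one, mul_one, mul_assoc, inv_mul_cancel_right₀ ht0]
      exact ⟨rfl, hy.2⟩
    · intro y _
      simp [ht0]
    · intro y _
      simp [ht0]
  have hright : ∀ y ∈ ({y : F | y ^ ((s - 1) * e) = 1} : Finset F),
      #(bipartiteAbove (fun y t => Algebra.trace (ZMod p) F (a * y * t) ≠ 0)
        ({t : F | t ^ (s - 1) = 1} : Finset F) y) * p =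
      if (a * y) ^ (s - 1) = -1 then 0 else (p - 1) * s := by
    intro y hy
    simp only [mem_filter, mem_univ, true_and] at hy
    have hy0 : y ≠ 0 := by
      rintro rfl
      simp [hcpos.ne'] at hy
    rw [bipartiteAbove, filter_filter]
    exact card_filter_trace_mul_ne_zero_mul hp hk hF hζ (mul_ne_zero ha hy0)
  rw [sum_congr rfl hleft, sum_const, hT, smul_eq_mul] at hswap
  refine Nat.eq_of_mul_eq_mul_left (show 0 < s - 1 by omega) ?_
  rw [← mul_assoc, ← hswap, sum_mul, sum_congr rfl hright, sum_ite, sum_const_zero, zero_add, sum_const,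
    filter_filter, hN', smul_eq_mul]
  ring

end Cubes

/-! ### Support size as a sum of weights -/

section Code

variable {K : Type*} [Field K] [Fintype K] [DecidableEq K] {n : ℕ}

/-- Each coordinate in the support is a nonzero functional on `U`, so it is nonzero on the same
proportion of `U`. -/
theorem sum_hammingNorm_mul_card (U : Submodule K (Fin n → K)) [Fintype U] :
    (∑ x : U, hammingNorm (x : Fin n → K)) * Fintype.card K =
      (codeSupport U).ncard * ((Fintype.card K - 1) * Fintype.card U) := by
  classical
  have hswap := sum_card_bipartiteAbove_eq_sum_card_bipartiteBelow
    (s := (univ : Finset U)) (t := (univ : Finset (Fin n)))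
    (fun (x : U) i => (x : Fin n → K) i ≠ 0)
  have h1 : ∑ x : U, hammingNorm (x : Fin n → K) =
      ∑ i : Fin n, #{x : U | (x : Fin n → K) i ≠ 0} := hswap
  have h2 : ∀ i : Fin n, #{x : U | (x : Fin n → K) i ≠ 0} * Fintype.card K =
      if i ∈ codeSupport U then (Fintype.card K - 1) * Fintype.card U else 0 := by
    intro i
    split_ifs with hi
    · obtain ⟨x, hx, hxi⟩ := hi
      exact card_filter_linearMap_ne_zero (LinearMap.proj i ∘ₗ U.subtype)
        fun h => hxi (LinearMap.congr_fun h ⟨x, hx⟩)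
    · rw [card_eq_zero.2, zero_mul]
      exact filter_eq_empty_iff.2 fun x _ hx => hi ⟨x, x.2, hx⟩
  rw [h1, sum_mul, sum_congr rfl fun i _ => h2 i, sum_ite, sum_const_zero, add_zero, sum_const,
    smul_eq_mul, ← Set.ncard_coe_finset]
  simp

theorem mul_card_le_ncard_codeSupport_mul (U : Submodule K (Fin n → K)) {b c : ℕ}
    (h : ∀ x ∈ U, x ≠ 0 → c ≤ hammingNorm x * b) :
    (Nat.card U - 1) * c * Fintype.card K ≤
      (codeSupport U).ncard * ((Fintype.card K - 1) * Nat.card U) * b := by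
  classical
  have : Fintype U := Fintype.ofFinite _
  rw [Nat.card_eq_fintype_card, ← sum_hammingNorm_mul_card, mul_right_comm _ _ b, sum_mul]
  refine Nat.mul_le_mul_right _ ?_
  calc (Fintype.card U - 1) * c = ∑ _x ∈ univ.erase (0 : U), c := by
        rw [sum_const, card_erase_of_mem (mem_univ _), card_univ, smul_eq_mul]
    _ ≤ ∑ x ∈ univ.erase (0 : U), hammingNorm (x : Fin n → K) * b :=
        sum_le_sum fun x hx => h x x.2 fun h0 => (mem_erase.1 hx).1 (Subtype.ext h0)
    _ ≤ _ := sum_le_sum_of_subset (erase_subset _ _)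

theorem mul_card_eq_ncard_codeSupport_mul (U : Submodule K (Fin n → K)) {b c : ℕ}
    (h : ∀ x ∈ U, x ≠ 0 → hammingNorm x * b = c) :
    (codeSupport U).ncard * ((Fintype.card K - 1) * Nat.card U) * b =
      (Nat.card U - 1) * c * Fintype.card K := by
  classical
  have : Fintype U := Fintype.ofFinite _
  rw [Nat.card_eq_fintype_card, ← sum_hammingNorm_mul_card, mul_right_comm _ _ b, sum_mul,
    ← add_sum_erase _ _ (mem_univ (0 : U)), ZeroMemClass.coe_zero, hammingNorm_zero, zero_mul,
    zero_add, sum_congr rfl fun (x : U) hx =>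
      h x x.2 fun h0 => (mem_erase.1 hx).1 (Subtype.ext h0),
    sum_const, card_erase_of_mem (mem_univ _), card_univ, smul_eq_mul]

end Code

/-! ### Weights of the trace code -/

section TraceCode

variable {p : ℕ} [Fact p.Prime] {F : Type*} [Field F] [Algebra (ZMod p) F]

theorem exists_algebraMap_eq_of_pow_eq_one {u : F} (hu : u ^ (p - 1) = 1) :
    ∃ c : ZMod p, c ≠ 0 ∧ algebraMap (ZMod p) F c = u := by
  have hp1 := (Fact.out : p.Prime).one_lt
  have : CharP F p := charP_of_injective_algebraMap (algebraMap (ZMod p) F).injective p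
  have hu0 : u ≠ 0 := by
    rintro rfl
    simp [show p - 1 ≠ 0 by omega] at hu
  have hup : u ^ p = u := by
    conv_lhs => rw [show p = p - 1 + 1 by omega, pow_succ, hu, one_mul]
  obtain ⟨c, hc⟩ := (bot_le : ⊥ ≤ (algebraMap (ZMod p) F).fieldRange)
    ((Subfield.mem_bot_iff_pow_eq_self F p).2 hup)
  refine ⟨c, ?_, hc⟩
  rintro rfl
  exact hu0 (by rw [← hc, map_zero])

theorem exists_mul_eq_of_pow_eq_one {q' N n M l g c : ℕ} {α : F} (hα : IsPrimitiveRoot α q')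
    (hq : q' ≠ 0) (hN : N * n = q') (hM : M * l = q') (hg : Nat.gcd N M = g) (hc : g * c = q')
    {y : F} (hy : y ^ c = 1) : ∃ u v : F, u ^ l = 1 ∧ v ^ n = 1 ∧ u * v = y := by
  have hα0 : α ≠ 0 := hα.ne_zero hq
  have hprim : IsPrimitiveRoot (α ^ g) c := hα.pow (Nat.pos_of_ne_zero hq) hc.symm
  have : NeZero c := ⟨by rintro rfl; exact hq (by simp [← hc])⟩
  obtain ⟨i, -, rfl⟩ := hprim.eq_pow_of_pow_eq_one hy
  have key : ∀ (a b : ℕ) (z : ℤ), a * b = q' → ((α ^ a) ^ z) ^ b = 1 := fun a b z h => by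
    rw [← zpow_natCast, ← zpow_mul, mul_comm, zpow_mul, zpow_natCast, ← pow_mul, h,
      hα.pow_eq_one, one_zpow]
  -- Bézout coefficients for `g = gcd N M`; they may be negative, hence integer powers.
  refine ⟨(α ^ M) ^ (Nat.gcdB N M * i), (α ^ N) ^ (Nat.gcdA N M * i), key _ _ _ hM, key _ _ _ hN, ?_⟩
  rw [← zpow_natCast α, ← zpow_natCast α, ← zpow_mul, ← zpow_mul, ← zpow_add₀ hα0, ← pow_mul,
    ← zpow_natCast α]
  congr 1
  push_cast
  rw [← hg, Nat.gcd_eq_gcd_ab]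
  ring

theorem hammingNorm_trace_mul_pow [Fintype F] [DecidableEq F] {n : ℕ} (hn : 0 < n) {θ : F}
    (hθ : IsPrimitiveRoot θ n) (a : F) :
    hammingNorm (fun i : Fin n => Algebra.trace (ZMod p) F (a * θ ^ (i : ℕ))) =
      #{x : F | x ^ n = 1 ∧ Algebra.trace (ZMod p) F (a * x) ≠ 0} := by
  have : NeZero n := ⟨hn.ne'⟩
  refine card_bij (fun i _ => θ ^ (i : ℕ)) ?_ ?_ ?_
  · intro i hi
    simp only [mem_filter, mem_univ, true_and] at hi ⊢
    exact ⟨by rw [← pow_mul, mul_comm, pow_mul, hθ.pow_eq_one, one_pow], hi⟩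
  · intro i _ j _ h
    exact Fin.ext (hθ.pow_inj i.2 j.2 h)
  · intro x hx
    simp only [mem_filter, mem_univ, true_and] at hx
    obtain ⟨i, hi, rfl⟩ := hθ.eq_pow_of_pow_eq_one hx.1
    exact ⟨⟨i, hi⟩, by simpa using hx.2, rfl⟩

open Classical in
theorem hammingNorm_traceCode_mul [Finite F] (hp : p ≠ 2) {k : ℕ} (hk : k ≠ 0)
    (hF : Nat.card F = (p ^ k) ^ 2) {α : F} (hα : IsPrimitiveRoot α ((p ^ k) ^ 2 - 1))
    {e : ℕ} (he : 3 * e = p ^ k + 1) (he2 : Even e) {N n : ℕ} (hN : N * n = (p ^ k) ^ 2 - 1)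
    (hgcd : Nat.gcd N (((p ^ k) ^ 2 - 1) / (p - 1)) = 3) {a : F} (ha : a ≠ 0) :
    hammingNorm (fun i : Fin n => Algebra.trace (ZMod p) F (a * (α ^ N) ^ (i : ℕ))) * (N * p) =
      (p - 1) * p ^ k * (p ^ k + 1 - if a ^ ((p ^ k - 1) * e) = 1 then 3 else 0) := by
  have : Fintype F := Fintype.ofFinite F
  have hp1 := (Fact.out : p.Prime).one_lt
  have h1 : 1 < p ^ k := Nat.one_lt_pow hk hp1
  have hcubes := card_cubes_trace_ne_zero_mul hp hk hF hα he he2 ha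
  have hdvd : p - 1 ∣ p ^ k - 1 := by simpa using Nat.sub_dvd_pow_sub_pow p 1 k
  set s := p ^ k with hs
  have hsq : s ^ 2 - 1 = 3 * ((s - 1) * e) := by
    rw [mul_left_comm, he, mul_comm, ← Nat.sq_sub_sq, one_pow]
  have he0 : 0 < e := by omega
  have hcpos : 0 < (s - 1) * e := Nat.mul_pos (by omega) he0
  have hpos : 0 < s ^ 2 - 1 := by omega
  have hn : 0 < n := Nat.pos_of_ne_zero (by rintro rfl; omega)
  have hP : #{y : F | y ^ ((s - 1) * e) = 1} = (s - 1) * e :=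
    card_filter_pow_eq_one (hα.pow hpos hsq) hcpos
  have hθ : IsPrimitiveRoot (α ^ N) n := hα.pow hpos hN.symm
  obtain ⟨N', rfl⟩ : 3 ∣ N := hgcd ▸ Nat.gcd_dvd_left _ _
  have hnc : N' * n = (s - 1) * e := by
    have : 3 * (N' * n) = 3 * ((s - 1) * e) := by rw [← hsq, ← hN, mul_assoc]
    omega
  have hM : (s ^ 2 - 1) / (p - 1) * (p - 1) = s ^ 2 - 1 := by
    refine Nat.div_mul_cancel (hdvd.trans ?_)
    rw [hsq]
    exact ⟨3 * e, by ring⟩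
  have hdens := card_filter_mul_card_eq (F := F) (a := p - 1) (b := n) (c := (s - 1) * e)
    hn.ne' (by omega) (hdvd.mul_right e) ⟨N', by rw [← hnc, mul_comm]⟩
    (fun y hy => exists_mul_eq_of_pow_eq_one hα hpos.ne' hN hM hgcd hsq.symm hy)
    (fun x => Algebra.trace (ZMod p) F (a * x) ≠ 0) (fun u y hu => by
      obtain ⟨c, hc, rfl⟩ := exists_algebraMap_eq_of_pow_eq_one hu
      rw [mul_left_comm, ← Algebra.smul_def, map_smul, smul_eq_mul, mul_ne_zero_iff,
        and_iff_right hc])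
  rw [hP, card_filter_pow_eq_one hθ hn, ← hammingNorm_trace_mul_pow hn hθ] at hdens
  set w := hammingNorm (fun i : Fin n => Algebra.trace (ZMod p) F (a * (α ^ (3 * N')) ^ (i : ℕ)))
  have hw : w * N' = #{y : F | y ^ ((s - 1) * e) = 1 ∧ Algebra.trace (ZMod p) F (a * y) ≠ 0} := by
    refine Nat.eq_of_mul_eq_mul_left hn ?_
    rw [← hdens, ← hnc]
    ring
  calc w * (3 * N' * p) = 3 * (w * N' * p) := by ring
    _ = (p - 1) * s * (3 * (e - if a ^ ((s - 1) * e) = 1 then 1 else 0)) := by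
      rw [hw, hcubes]; ring
    _ = _ := by
      rw [Nat.mul_sub, he]
      split_ifs <;> rfl

end TraceCode

end

/-! ### The main theorem -/

theorem mainTheorem10 (p : ℕ) [Fact p.Prime] (hp_odd : p ≠ 2)
    (m n₁ q N N₁ : ℕ) (hn₁_pos : 0 < n₁) (hn₁_cop : n₁.Coprime p)
    (hm : IsLeast {k : ℕ | 0 < k ∧ p ^ k ≡ 1 [MOD n₁]} m)
    (hq : q = p ^ m) (hN : N = (q - 1) / n₁) (hN₁ : N₁ = Nat.gcd N ((q - 1) / (p - 1)))
    {F : Type*} [Field F] [Finite F] [Algebra (ZMod p) F] (hF : Nat.card F = q)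
    (α θ : F) (hα : IsPrimitiveRoot α (q - 1)) (hθ : θ = α ^ N)
    (hN₁_three : N₁ = 3) (hp_mod : p ≡ 2 [MOD 3]) (hm_mod : m ≡ 2 [MOD 4])
    (r : ℕ) (hr_pos : 1 ≤ r) (hr_le : r ≤ m / 2) :
    (genHammingWeight (traceCode (ZMod p) (fun i : Fin n₁ => θ ^ (i : ℕ))) r : ℝ) =
      (1 - 1 / (p : ℝ) ^ r) * (((q : ℝ) - 2 * Real.sqrt (q : ℝ)) / (N : ℝ)) := by
  classical
  have hp1 := (Fact.out : p.Prime).one_lt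
  obtain ⟨k, rfl⟩ : ∃ k, m = k * 2 := ⟨m / 2, by simp only [Nat.ModEq] at hm_mod; omega⟩
  rw [Nat.mul_div_cancel _ two_pos] at hr_le
  have hk : k ≠ 0 := by omega
  have hkodd : Odd k := by
    rw [Nat.odd_iff]
    simp only [Nat.ModEq] at hm_mod
    omega
  have h1 : 1 < p ^ k := Nat.one_lt_pow hk hp1
  have hs3 : p ^ k % 3 = 2 := by
    obtain ⟨j, rfl⟩ := hkodd
    have h4 : (2 : ℕ) ^ 2 ≡ 1 [MOD 3] := rfl
    have : p ^ (2 * j + 1) ≡ 2 [MOD 3] := (hp_mod.pow _).trans <| by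
      simpa [pow_succ, pow_mul] using (h4.pow j).mul_right 2
    exact this
  have hsodd : Odd (p ^ k) := ((Fact.out : p.Prime).odd_of_ne_two hp_odd).pow
  obtain ⟨e, he⟩ : ∃ e, 3 * e = p ^ k + 1 := ⟨(p ^ k + 1) / 3, by omega⟩
  have he2 : Even e := by
    rw [Nat.even_iff]
    rw [Nat.odd_iff] at hsodd
    omega
  have hqs : q = (p ^ k) ^ 2 := by rw [hq, pow_mul]
  have hNn : N * n₁ = (p ^ k) ^ 2 - 1 := by
    rw [hN, ← hqs]
    refine Nat.div_mul_cancel ?_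
    rw [hq]
    exact (Nat.modEq_iff_dvd' (Nat.one_le_pow _ _ (by omega))).1 hm.1.2.symm
  subst hqs hθ hN₁
  have hwt := fun {a : F} (ha : a ≠ 0) =>
    hammingNorm_traceCode_mul hp_odd hk hF hα he he2 hNn hN₁_three ha
  set s := p ^ k with hs
  have hNpos : 0 < N := Nat.pos_of_ne_zero (by
    rintro rfl
    have := Nat.one_lt_pow two_ne_zero h1
    omega)
  let φ : F →ₗ[ZMod p] (Fin n₁ → ZMod p) := LinearMap.pi fun i =>
    Algebra.trace (ZMod p) F ∘ₗ LinearMap.mulRight (ZMod p) ((α ^ N) ^ (i : ℕ))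
  have hφ : ∀ a : F, φ a = fun i : Fin n₁ =>
    Algebra.trace (ZMod p) F (a * (α ^ N) ^ (i : ℕ)) := fun a => rfl
  have hφinj : Function.Injective φ := by
    rw [← LinearMap.ker_eq_bot, LinearMap.ker_eq_bot']
    intro a ha
    by_contra ha0
    have := hwt ha0
    rw [← hφ, ha, hammingNorm_zero, zero_mul] at this
    -- Every nonzero `a` has positive weight; in the cube case this needs `s > 2`, given by `s` odd.
    have h2 : 0 < (p - 1) * s * (s + 1 - if a ^ ((s - 1) * e) = 1 then 3 else 0) := by
      refine Nat.mul_pos (Nat.mul_pos (by omega) (by omega)) ?_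
      rw [Nat.odd_iff] at hsodd
      split_ifs <;> omega
    omega
  have hcard : ∀ U : Submodule (ZMod p) (Fin n₁ → ZMod p), Module.finrank (ZMod p) U = r →
      Nat.card U = p ^ r := fun U hU => by
    rw [Module.natCard_eq_pow_finrank (K := ZMod p), Nat.card_zmod, hU]
  have hpos : 0 < (p - 1) * p := Nat.mul_pos (by omega) (by omega)
  have hlower : ∀ U ≤ traceCode (ZMod p) (fun i : Fin n₁ => (α ^ N) ^ (i : ℕ)),
      Module.finrank (ZMod p) U = r →
      (p ^ r - 1) * (s * (s - 2)) ≤ (codeSupport U).ncard * (p ^ r * N) := by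
    intro U hU hUr
    have := mul_card_le_ncard_codeSupport_mul U (b := N * p) (c := (p - 1) * s * (s - 2)) ?_
    · rw [hcard U hUr, ZMod.card] at this
      refine Nat.le_of_mul_le_mul_left (c := (p - 1) * p) ?_ hpos
      convert this using 1 <;> ring
    · rintro x hx hx0
      obtain ⟨a, rfl⟩ := hU hx
      have ha : a ≠ 0 := by
        rintro rfl
        exact hx0 (map_zero _)
      refine (Nat.mul_le_mul_left _ ?_).trans (hwt ha).ge
      split_ifs <;> omega
  have hattain : ∃ U ≤ traceCode (ZMod p) (fun i : Fin n₁ => (α ^ N) ^ (i : ℕ)),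
      Module.finrank (ZMod p) U = r ∧
      (codeSupport U).ncard * (p ^ r * N) = (p ^ r - 1) * (s * (s - 2)) := by
    have hsq : s ^ 2 - 1 = (s - 1) * e * 3 := by
      rw [mul_assoc, mul_comm e, he, mul_comm, ← Nat.sq_sub_sq, one_pow]
    have hζ : IsPrimitiveRoot (α ^ (e * 3)) (p ^ k - 1) :=
      hα.pow (Nat.sub_pos_of_lt (Nat.one_lt_pow two_ne_zero h1)) (by rw [hsq]; ring)
    have hfin : Module.finrank (ZMod p) (fixedSubmodule p k F) = k := by
      refine Nat.pow_right_injective hp1 ?_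
      have := Module.natCard_eq_pow_finrank (K := ZMod p) (V := fixedSubmodule p k F)
      rw [card_fixedSubmodule hk hζ, Nat.card_zmod] at this
      exact this.symm
    obtain ⟨v, hv⟩ := exists_linearIndependent_of_le_finrank (hfin.symm ▸ hr_le)
    have hv' := hv.map' _ (fixedSubmodule p k F).ker_subtype
    have hv'' := hv'.map' φ (LinearMap.ker_eq_bot.2 hφinj)
    set U := Submodule.span (ZMod p) (Set.range (φ ∘ (fixedSubmodule p k F).subtype ∘ v)) with hU
    have hUle : U ≤ (fixedSubmodule p k F).map φ := by
      rw [hU, Submodule.span_le]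
      rintro _ ⟨i, rfl⟩
      exact ⟨_, (v i).2, rfl⟩
    have hUr : Module.finrank (ZMod p) U = r := by
      rw [hU, finrank_span_eq_card hv'', Fintype.card_fin]
    refine ⟨U, hUle.trans LinearMap.map_le_range, hUr, ?_⟩
    have := mul_card_eq_ncard_codeSupport_mul U (b := N * p) (c := (p - 1) * s * (s - 2)) ?_
    · rw [hcard U hUr, ZMod.card] at this
      refine Nat.eq_of_mul_eq_mul_left hpos ?_
      convert this using 1 <;> ring
    · rintro x hx hx0
      obtain ⟨a, haL, rfl⟩ := hUle hx
      have ha : a ≠ 0 := by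
        rintro rfl
        exact hx0 (map_zero _)
      -- Elements of `𝔽_s^*` are cubes, so all nonzero words of `U` have minimum weight.
      have hcube : a ^ ((s - 1) * e) = 1 := by
        rw [pow_mul, (pow_eq_self_iff_of_ne_zero ha).1 haL, one_pow]
      rw [hφ, hwt ha, if_pos hcube]
      rfl
  obtain ⟨U, hU, hUr, hUeq⟩ := hattain
  have hprN : 0 < p ^ r * N := Nat.mul_pos (by positivity) hNpos
  have hleast : IsLeast {w | ∃ U : Submodule (ZMod p) (Fin n₁ → ZMod p),
      U ≤ traceCode (ZMod p) (fun i : Fin n₁ => (α ^ N) ^ (i : ℕ)) ∧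
      Module.finrank (ZMod p) U = r ∧ (codeSupport U).ncard = w} (codeSupport U).ncard := by
    refine ⟨⟨U, hU, hUr, rfl⟩, ?_⟩
    rintro _ ⟨V, hV, hVr, rfl⟩
    exact Nat.le_of_mul_le_mul_right (hUeq.trans_le (hlower V hV hVr)) hprN
  rw [genHammingWeight, hleast.csInf_eq]
  have hreal : ((codeSupport U).ncard : ℝ) * ((p : ℝ) ^ r * N) =
      ((p : ℝ) ^ r - 1) * (s * (s - 2)) := by
    have := congrArg (Nat.cast : ℕ → ℝ) hUeq
    rwa [Nat.cast_mul, Nat.cast_mul, Nat.cast_mul, Nat.cast_mul,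
      Nat.cast_sub (Nat.one_le_pow _ _ (by omega)), Nat.cast_sub (by omega), Nat.cast_pow,
      Nat.cast_one, Nat.cast_ofNat] at this
  have hN0 : (N : ℝ) ≠ 0 := by exact_mod_cast hNpos.ne'
  have hp0 : (p : ℝ) ≠ 0 := by exact_mod_cast (by omega : p ≠ 0)
  rw [Nat.cast_pow, Real.sqrt_sq (Nat.cast_nonneg _)]
  field_simp
  linear_combination hreal
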